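/- Let $K$ be a field and let $G$ be a graph with vertex set $[n]=\{1,\dots,n\}$. The Hankel edge ideal $I_G$ of $G$ is the ideal of $S=K[x_1,\dots,x_{n+1}]$ generated by the binomials $g_{ij}=x_ix_{j+1}-x_jx_{i+1}$ for all edges $\{i,j\}$ of $G$ with $i<j$. For a homogeneous ideal $I$ of $S$, the ring $S/I$ is called a complete intersection if the minimal number of generators $\mu(I)$ of $I$ equals $\operatorname{height} I$. A tree $T$ with vertex set $[n]$ has a rooted labeling if its labels arise by the following procedure: a vertex, the root, receives the label $1$; then the vertices are processed in increasing order of their labels $i=1,2,\dots$, and when the vertex $i$ is processed, its neighbors that are still unlabeled receive the next consecutive unused labels, in an arbitrary order. **Theorem.** Let $T$ be a tree on $n$ vertices with a rooted labeling. If $T$ is not a path, then $\operatorname{height} I_T\le n-2$. In particular, $S/I_T$ is not a complete intersection. -/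

import Mathlib

/-- The binomial `g_{ij} = x_i x_{j+1} - x_j x_{i+1}` in `K[x_1, …, x_{n+1}]`, for vertices `i`, `j`.
The vertices `1, …, n` are represented by `Fin n` and the variables `x_1, …, x_{n+1}` are indexed
by `Fin (n + 1)`: for a vertex `i`, the variable `x_i` is `X i.castSucc` and `x_{i+1}` is
`X i.succ`. -/
noncomputable def hankelBinomial (K : Type*) [Field K] {n : ℕ} (i j : Fin n) :
    MvPolynomial (Fin (n + 1)) K :=
  MvPolynomial.X i.castSucc * MvPolynomial.X j.succ -
    MvPolynomial.X j.castSucc * MvPolynomial.X i.succ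

/-- The Hankel edge ideal `I_G` of a graph `G` with vertex set `[n]`. -/
noncomputable def hankelEdgeIdeal (K : Type*) [Field K] {n : ℕ} (G : SimpleGraph (Fin n)) :
    Ideal (MvPolynomial (Fin (n + 1)) K) :=
  Ideal.span {f | ∃ i j : Fin n, i < j ∧ G.Adj i j ∧ f = hankelBinomial K i j}

/-- For a homogeneous ideal `I` of a polynomial ring `S`, the quotient `S/I` is a complete
intersection if the minimal number of generators of `I` is equal to the height of `I`. -/
def IsCompleteIntersectionQuotient {K : Type*} [Field K] {m : ℕ}
    (I : Ideal (MvPolynomial (Fin m) K)) : Prop :=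
  (I.spanFinrank : ℕ∞) = I.height

/-- The labels of a tree `T` on `[n]` form a rooted labeling. The labels are given out
consecutively: the root gets the first label, and then the vertices are processed in increasing
order of their labels, where processing `i` means giving the next free labels to those neighbors
of `i` that are still unlabeled. Here `c i` is the number of labels in use just before the vertex
`i : Fin n` is processed, so that at this moment the labeled vertices are the `j : Fin n` with
`j < c i`, and `i` has to be one of them. The unlabeled neighbors of `i` then become exactly the
vertices `j` with `c i ≤ j < c (i + 1)`. -/
def IsRootedLabeling {n : ℕ} (T : SimpleGraph (Fin n)) : Prop :=
  ∃ c : ℕ → ℕ, c 0 = 1 ∧ Monotone c ∧ (∀ k, c k ≤ n) ∧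
    ∀ i : Fin n, (i : ℕ) < c i ∧
      {j : Fin n | T.Adj i j ∧ c i ≤ j} = {j : Fin n | c i ≤ j ∧ (j : ℕ) < c (i + 1)}

/-- `G` is a path, i.e. it is isomorphic to the path on `n` vertices, whatever its labels are. -/
def IsPathGraph {n : ℕ} (G : SimpleGraph (Fin n)) : Prop :=
  Nonempty (G ≃g SimpleGraph.pathGraph n)

/-! A tree that is not a path has a vertex `v` of degree at least 3. The ideal generated by `x_v`,
`x_{v+1}` and the binomials of the edges avoiding `v` is proper and contains `I_T`. It has at most
`2 + (n - 1 - deg v) ≤ n - 2` generators, so Krull's height theorem gives the height bound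
(`height_hankelEdgeIdeal_add_degree_le`). On the other hand, the `n - 1` edge binomials are linearly
independent quadrics and `I_T` contains no terms of lower degree, so `μ(I_T) ≥ n - 1`, which exceeds
the height. -/

open MvPolynomial

/-! ### Trees of maximal degree at most two -/

namespace SimpleGraph

variable {V : Type*} {G : SimpleGraph V}

/-- In a connected graph of maximal degree at most two, a path of maximal length visits every
vertex. -/
theorem Connected.mem_support_of_forall_length_le [Fintype V] [DecidableRel G.Adj]
    (hG : G.Connected) (hdeg : ∀ v, G.degree v ≤ 2) {u v : V} {p : G.Walk u v} (hp : p.IsPath)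
    (hmax : ∀ (u' v' : V) (q : G.Walk u' v'), q.IsPath → q.length ≤ p.length) (w : V) :
    w ∈ p.support := by
  classical
  by_contra hw
  obtain ⟨q⟩ := hG.preconnected u w
  -- Some edge `ab` leaves the path. If `a` is an endpoint, the path extends; if `a` is interior,
  -- `b` is its third neighbor.
  obtain ⟨d, -, hd₁, hd₂⟩ := q.exists_boundary_dart {x | x ∈ p.support} (by simp) hw
  obtain ⟨⟨a, b⟩, hab⟩ := d
  simp only [Set.mem_ofPred_eq] at hd₁ hd₂ hab
  obtain ⟨i, rfl, hi⟩ := Walk.mem_support_iff_exists_getVert.mp hd₁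
  rcases Nat.eq_zero_or_pos i with rfl | hi0
  · rw [Walk.getVert_zero] at hab
    have := hmax _ _ (Walk.cons hab.symm p) (hp.cons hd₂)
    simp at this
  rcases hi.eq_or_lt with rfl | hil
  · rw [Walk.getVert_length] at hab
    have := hmax _ _ (p.concat hab) (hp.concat hd₂ hab)
    simp at this
  obtain ⟨k, rfl⟩ : ∃ k, i = k + 1 := ⟨i - 1, by omega⟩
  have h₁ : G.Adj (p.getVert (k + 1)) (p.getVert k) := (p.adj_getVert_succ (by omega)).symm
  have h₂ : G.Adj (p.getVert (k + 1)) (p.getVert (k + 2)) := p.adj_getVert_succ hil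
  have h₃ : p.getVert k ≠ p.getVert (k + 2) := fun h => by
    have := hp.getVert_injOn (by simp; omega) (by simp; omega) h
    omega
  have h₄ : ∀ j, p.getVert j ≠ b := fun j h => hd₂ (h ▸ p.getVert_mem_support j)
  have hsub : ({p.getVert k, p.getVert (k + 2), b} : Finset V) ⊆
      G.neighborFinset (p.getVert (k + 1)) := by
    intro x hx
    simp only [Finset.mem_insert, Finset.mem_singleton] at hx
    rw [mem_neighborFinset]
    rcases hx with rfl | rfl | rfl <;> assumption
  have hcard := Finset.card_le_card hsub
  rw [Finset.card_eq_three.mpr ⟨_, _, _, h₃, h₄ _, h₄ _, rfl⟩, card_neighborFinset_eq_degree]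
    at hcard
  have := hdeg (p.getVert (k + 1))
  omega

/-- A tree of maximal degree at most two is a path. -/
theorem IsTree.nonempty_iso_pathGraph [Fintype V] [DecidableRel G.Adj] (hG : G.IsTree)
    (hdeg : ∀ v, G.degree v ≤ 2) : Nonempty (G ≃g pathGraph (Fintype.card V)) := by
  classical
  have := hG.connected.nonempty
  obtain ⟨u, v, p, hp, hmax⟩ := Walk.exists_isPath_forall_isPath_length_le_length G
  have hmem := hG.connected.mem_support_of_forall_length_le hdeg hp hmax
  have hham : p.IsHamiltonian := hp.isHamiltonian_of_mem hmem
  have hlen : p.length + 1 = Fintype.card V := by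
    rw [← hham.length_support, Walk.length_support]
  have hspan : p.toSubgraph.IsSpanning := fun w => p.mem_verts_toSubgraph.mpr (hmem w)
  have hle : p.toSubgraph.spanningCoe ≤ G := p.toSubgraph.spanningCoe_le
  have hconn : p.toSubgraph.spanningCoe.Connected :=
    (p.toSubgraph.spanningCoeEquivCoeOfSpanning hspan).connected_iff.mpr
      p.toSubgraph_connected.coe
  -- A tree is minimally connected, so it has no edges beyond those of the path.
  have heq : p.toSubgraph.spanningCoe = G :=
    le_antisymm hle ((isTree_iff_minimal_connected.mp hG).2 hconn hle)
  rw [← hlen]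
  have e := (p.toSubgraph.spanningCoeEquivCoeOfSpanning hspan).trans
    hp.pathGraphIsoToSubgraph.symm
  rw [heq] at e
  exact ⟨e⟩

end SimpleGraph

/-! ### Lower bounds for the number of generators -/

namespace MvPolynomial

variable {σ K : Type*} [Field K]

theorem mem_pow_idealOfVars_of_isHomogeneous {p : MvPolynomial σ K} {d : ℕ}
    (hp : p.IsHomogeneous d) : p ∈ idealOfVars σ K ^ d := by
  rw [mem_pow_idealOfVars_iff']
  intro m hm
  exact hp.coeff_eq_zero hm.ne

/-- Since `p` has no terms of degree below `d`, only the constant term of `a` contributes in degree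
`d`. -/
theorem homogeneousComponent_mul_of_mem_pow_idealOfVars {d : ℕ} (a : MvPolynomial σ K)
    {p : MvPolynomial σ K} (hp : p ∈ idealOfVars σ K ^ d) :
    homogeneousComponent d (a * p) = constantCoeff a • homogeneousComponent d p := by
  classical
  rw [mem_pow_idealOfVars_iff'] at hp
  ext m
  rw [coeff_smul, coeff_homogeneousComponent, coeff_homogeneousComponent]
  split_ifs with hm
  · rw [coeff_mul, Finset.sum_eq_single (0, m)]
    · simp [constantCoeff_eq]
    · rintro ⟨x, y⟩ hxy hne
      rw [Finset.HasAntidiagonal.mem_antidiagonal] at hxy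
      dsimp only at hxy
      rw [hp y, mul_zero]
      rw [← hm, ← hxy, map_add]
      have : x ≠ 0 := by
        rintro rfl
        exact hne (by simpa using hxy)
      have : x.degree ≠ 0 := (Finsupp.degree_eq_zero_iff x).not.mpr this
      omega
    · simp
  · simp

/-- If an ideal is contained in the `d`-th power of the irrelevant ideal, then it needs at least as
many generators as it contains linearly independent forms of degree `d`. -/
theorem card_le_spanFinrank_of_linearIndependent [Finite σ] {ι : Type*} [Fintype ι] {d : ℕ}
    {I : Ideal (MvPolynomial σ K)} (hI : I ≤ idealOfVars σ K ^ d) {f : ι → MvPolynomial σ K}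
    (hf : LinearIndependent K f) (hhom : ∀ i, (f i).IsHomogeneous d) (hmem : ∀ i, f i ∈ I) :
    Fintype.card ι ≤ I.spanFinrank := by
  classical
  obtain ⟨s, hs, hspan⟩ := Submodule.FG.exists_span_finset_card_eq_spanFinrank
    ((isNoetherian_def.mp (inferInstance : IsNoetherianRing (MvPolynomial σ K))) I)
  -- Over `K`, the degree-`d` components of the generators already span all forms of degree `d` in
  -- `I`.
  have hle : Submodule.span K (Set.range f) ≤
      Submodule.span K ((s.image (homogeneousComponent d) : Finset (MvPolynomial σ K)) :
        Set (MvPolynomial σ K)) := by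
    rw [Submodule.span_le]
    rintro _ ⟨i, rfl⟩
    have hi := hmem i
    rw [← hspan, Submodule.mem_span_finset] at hi
    obtain ⟨a, -, ha⟩ := hi
    have hfi : homogeneousComponent d (f i) = f i := by
      rw [homogeneousComponent_of_mem (hhom i), if_pos rfl]
    rw [SetLike.mem_coe, ← hfi, ← ha, map_sum]
    refine Submodule.sum_mem _ fun g hg => ?_
    have hgI : g ∈ I := hspan ▸ Submodule.subset_span hg
    rw [smul_eq_mul, homogeneousComponent_mul_of_mem_pow_idealOfVars _ (hI hgI)]
    exact Submodule.smul_mem _ _ (Submodule.subset_span (Finset.mem_coe.mpr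
      (Finset.mem_image_of_mem _ hg)))
  calc Fintype.card ι = Module.finrank K (Submodule.span K (Set.range f)) :=
        (finrank_span_eq_card hf).symm
    _ ≤ _ := Submodule.finrank_mono hle
    _ ≤ (s.image (homogeneousComponent d)).card := finrank_span_finset_le_card _
    _ ≤ s.card := Finset.card_image_le
    _ = _ := hs

end MvPolynomial

/-! ### Generators and height of Hankel edge ideals -/

section Hankel

variable {K : Type*} [Field K] {n : ℕ}

theorem isHomogeneous_hankelBinomial (i j : Fin n) : (hankelBinomial K i j).IsHomogeneous 2 :=
  ((isHomogeneous_X K _).mul (isHomogeneous_X K _)).sub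
    ((isHomogeneous_X K _).mul (isHomogeneous_X K _))

theorem coeff_X_mul_X [DecidableEq (Fin n)] (a b c d : Fin n) :
    coeff (Finsupp.single a 1 + Finsupp.single b 1) (X c * X d : MvPolynomial (Fin n) K) =
      if (c = a ∧ d = b) ∨ (c = b ∧ d = a) then 1 else 0 := by
  rw [X, X, monomial_mul, coeff_monomial, mul_one]
  refine if_congr ?_ rfl rfl
  rw [Finsupp.single_add_single_eq_single_add_single one_ne_zero one_ne_zero]
  simp

/-- Besides `g_{i,j}`, the monomial `x_i x_{j+1}` can occur only in `g_{i-1,j+1}`, whose first index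
is smaller; hence the induction on the first index. -/
theorem linearIndependent_hankelBinomial :
    LinearIndependent K
      (fun p : {p : Fin n × Fin n // p.1 < p.2} => hankelBinomial K p.1.1 p.1.2) := by
  classical
  rw [Fintype.linearIndependent_iff]
  intro g hg
  suffices h : ∀ (m : ℕ) (p : {p : Fin n × Fin n // p.1 < p.2}), (p.1.1 : ℕ) = m → g p = 0 from
    fun p => h _ p rfl
  intro m
  induction m using Nat.strong_induction_on with
  | _ m ih =>
    rintro ⟨⟨i, j⟩, hij⟩ hm
    dsimp only at hij hm
    have hc := congrArg (coeff (Finsupp.single i.castSucc 1 + Finsupp.single j.succ 1)) hg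
    rw [coeff_sum, Finset.sum_eq_single ⟨(i, j), hij⟩ _ (by simp)] at hc
    · have h₁ : i.castSucc ≠ j.succ := fun h => by
        have := congrArg Fin.val h
        simp at this
        omega
      have h₂ : i.succ ≠ j.succ := fun h => hij.ne (Fin.succ_injective _ h)
      have h₃ : i.succ ≠ i.castSucc := fun h => by
        have := congrArg Fin.val h
        simp at this
      simpa [hankelBinomial, coeff_X_mul_X, h₁, h₂, h₃] using hc
    · rintro ⟨⟨a, b⟩, hab⟩ - hne
      dsimp only at hab
      by_cases ha : (a : ℕ) < m
      · rw [ih a ha ⟨(a, b), hab⟩ rfl, zero_smul, coeff_zero]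
      · have hne' : ¬ (a = i ∧ b = j) := by
          rintro ⟨rfl, rfl⟩
          exact hne rfl
        rw [coeff_smul, hankelBinomial, coeff_sub, coeff_X_mul_X, coeff_X_mul_X, if_neg, if_neg]
        · simp
        · simp only [Fin.ext_iff, Fin.val_succ, Fin.val_castSucc]
          rw [Fin.lt_def] at hab hij
          omega
        · simp only [Fin.ext_iff, Fin.val_succ, Fin.val_castSucc] at hne' ⊢
          rw [Fin.lt_def] at hab hij
          omega

theorem hankelBinomial_mem_hankelEdgeIdeal {G : SimpleGraph (Fin n)} {i j : Fin n} (hij : i < j)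
    (h : G.Adj i j) : hankelBinomial K i j ∈ hankelEdgeIdeal K G :=
  Ideal.subset_span ⟨i, j, hij, h, rfl⟩

theorem hankelEdgeIdeal_le_idealOfVars_sq (G : SimpleGraph (Fin n)) :
    hankelEdgeIdeal K G ≤ idealOfVars (Fin (n + 1)) K ^ 2 := by
  refine Ideal.span_le.mpr ?_
  rintro _ ⟨i, j, -, -, rfl⟩
  exact mem_pow_idealOfVars_of_isHomogeneous (isHomogeneous_hankelBinomial i j)

theorem SimpleGraph.inf_lt_sup_of_mem_edgeSet {V : Type*} [LinearOrder V] {G : SimpleGraph V}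
    {e : Sym2 V} (he : e ∈ G.edgeSet) : e.inf < e.sup := by
  induction e with
  | _ a b => simpa using (G.mem_edgeSet.mp he).ne'

theorem SimpleGraph.adj_inf_sup_of_mem_edgeSet {V : Type*} [LinearOrder V] {G : SimpleGraph V}
    {e : Sym2 V} (he : e ∈ G.edgeSet) : G.Adj e.inf e.sup := by
  induction e with
  | _ a b =>
    rw [G.mem_edgeSet] at he
    rcases le_total a b with h | h
    · simpa [h] using he
    · simpa [h] using he.symm

/-- The Hankel edge ideal needs one generator for each edge. -/
theorem card_edgeFinset_le_spanFinrank_hankelEdgeIdeal (G : SimpleGraph (Fin n))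
    [Fintype G.edgeSet] : G.edgeFinset.card ≤ (hankelEdgeIdeal K G).spanFinrank := by
  classical
  let φ : G.edgeSet → {p : Fin n × Fin n // p.1 < p.2} :=
    fun e => ⟨(e.1.inf, e.1.sup), SimpleGraph.inf_lt_sup_of_mem_edgeSet e.2⟩
  have hφ : Function.Injective φ := fun e e' h => by
    have h' := congrArg Subtype.val h
    exact Subtype.ext (Sym2.inf_eq_inf_and_sup_eq_sup.mp (Prod.ext_iff.mp h'))
  rw [SimpleGraph.edgeFinset_card]
  exact card_le_spanFinrank_of_linearIndependent (hankelEdgeIdeal_le_idealOfVars_sq G)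
    (linearIndependent_hankelBinomial.comp φ hφ) (fun e => isHomogeneous_hankelBinomial _ _)
    (fun e => hankelBinomial_mem_hankelEdgeIdeal (SimpleGraph.inf_lt_sup_of_mem_edgeSet e.2)
      (SimpleGraph.adj_inf_sup_of_mem_edgeSet e.2))

/-- Setting `x_v = x_{v+1} = 0` kills all generators of the Hankel edge ideal that come from edges
at `v`. -/
theorem height_hankelEdgeIdeal_add_degree_le (G : SimpleGraph (Fin n)) [DecidableRel G.Adj]
    (v : Fin n) :
    (hankelEdgeIdeal K G).height + G.degree v ≤ (G.edgeFinset.card + 2 : ℕ) := by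
  classical
  let F : Finset (Sym2 (Fin n)) := G.edgeFinset \ G.incidenceFinset v
  have hF : F.card + G.degree v = G.edgeFinset.card := by
    rw [← G.card_incidenceFinset_eq_degree v]
    exact Finset.card_sdiff_add_card_eq_card (G.incidenceFinset_subset v)
  let S : Finset (MvPolynomial (Fin (n + 1)) K) :=
    {X v.castSucc, X v.succ} ∪ F.image fun e => hankelBinomial K e.inf e.sup
  have hS : S.card ≤ 2 + F.card :=
    (Finset.card_union_le _ _).trans (add_le_add Finset.card_le_two Finset.card_image_le)
  let J : Ideal (MvPolynomial (Fin (n + 1)) K) := Ideal.span (S : Set _)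
  have hX : ∀ k, (X k : MvPolynomial (Fin (n + 1)) K) ∈ idealOfVars (Fin (n + 1)) K :=
    fun k => Ideal.subset_span ⟨k, rfl⟩
  have hJvars : J ≤ idealOfVars (Fin (n + 1)) K := by
    refine Ideal.span_le.mpr fun f hf => ?_
    rw [Finset.mem_coe, Finset.mem_union, Finset.mem_insert, Finset.mem_singleton,
      Finset.mem_image] at hf
    rcases hf with (rfl | rfl) | ⟨e, -, rfl⟩
    · exact hX _
    · exact hX _
    · exact Ideal.pow_le_self two_ne_zero
        (mem_pow_idealOfVars_of_isHomogeneous (isHomogeneous_hankelBinomial _ _))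
  -- The unit ideal has height `⊤`, so Krull's bound needs `J` proper; here `J` lies in the
  -- irrelevant ideal.
  have hJtop : J ≠ ⊤ := by
    intro h
    have h1 : (C 1 : MvPolynomial (Fin (n + 1)) K) ∈ idealOfVars (Fin (n + 1)) K ^ 1 := by
      rw [pow_one]
      exact hJvars (h ▸ Submodule.mem_top)
    rw [C_mem_pow_idealOfVars_iff] at h1
    simp at h1
  have h₁ : X v.castSucc ∈ J := Ideal.subset_span (by simp [S])
  have h₂ : X v.succ ∈ J := Ideal.subset_span (by simp [S])
  have hIJ : hankelEdgeIdeal K G ≤ J := by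
    refine Ideal.span_le.mpr ?_
    rintro _ ⟨i, j, hij, hadj, rfl⟩
    rw [SetLike.mem_coe]
    by_cases hi : i = v
    · subst hi
      exact J.sub_mem (J.mul_mem_right _ h₁) (J.mul_mem_left _ h₂)
    by_cases hj : j = v
    · subst hj
      exact J.sub_mem (J.mul_mem_left _ h₂) (J.mul_mem_right _ h₁)
    refine Ideal.subset_span (Finset.mem_coe.mpr (Finset.mem_union_right _
      (Finset.mem_image.mpr ⟨s(i, j), ?_, by simp [hij.le]⟩)))
    simp only [F, Finset.mem_sdiff, SimpleGraph.mem_edgeFinset, SimpleGraph.mem_edgeSet,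
      SimpleGraph.mem_incidenceFinset, SimpleGraph.incidenceSet]
    refine ⟨hadj, fun h => ?_⟩
    rcases Sym2.mem_iff.mp h.2 with h | h
    · exact hi h.symm
    · exact hj h.symm
  have hheight : (hankelEdgeIdeal K G).height ≤ (2 + F.card : ℕ) :=
    calc (hankelEdgeIdeal K G).height ≤ J.height := Ideal.height_mono hIJ
      _ ≤ J.spanFinrank := J.height_le_spanFinrank hJtop
      _ ≤ (S.card : ℕ) := by
        rw [← Set.encard_coe_eq_coe_finsetCard]
        exact Submodule.spanFinrank_span_le_encard _
      _ ≤ _ := by exact_mod_cast hS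
  calc (hankelEdgeIdeal K G).height + G.degree v ≤ (2 + F.card : ℕ) + G.degree v := by gcongr
    _ = (G.edgeFinset.card + 2 : ℕ) := by
      rw [← hF]
      push_cast
      ring

end Hankel

theorem theorem3p1 {K : Type*} [Field K] {n : ℕ} (T : SimpleGraph (Fin n))
    (hT : T.IsTree) (hlab : IsRootedLabeling T) (hpath : ¬ IsPathGraph T) :
    (hankelEdgeIdeal K T).height + 2 ≤ (n : ℕ∞) ∧
      ¬ IsCompleteIntersectionQuotient (hankelEdgeIdeal K T) := by
  classical
  have hcard : T.edgeFinset.card + 1 = n := by simpa using hT.card_edgeFinset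
  obtain ⟨v, hv⟩ : ∃ v, 3 ≤ T.degree v := by
    by_contra! h
    have := hT.nonempty_iso_pathGraph fun v => Nat.le_of_lt_succ (h v)
    rw [Fintype.card_fin] at this
    exact hpath this
  have hle := height_hankelEdgeIdeal_add_degree_le (K := K) T v
  have hheight : (hankelEdgeIdeal K T).height + 2 ≤ (n : ℕ∞) := by
    have hfin : (hankelEdgeIdeal K T).height ≠ ⊤ := by
      intro h
      rw [h, top_add] at hle
      exact absurd hle (by simp)
    lift (hankelEdgeIdeal K T).height to ℕ using hfin with h
    norm_cast at hle ⊢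
    omega
  refine ⟨hheight, fun hci => ?_⟩
  have hgen := card_edgeFinset_le_spanFinrank_hankelEdgeIdeal (K := K) T
  rw [IsCompleteIntersectionQuotient] at hci
  rw [← hci] at hheight
  norm_cast at hheight
  omega
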